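/- For $k\ge 2$ and pairwise distinct nodes $x_1,\dots,x_{2k-1}\in\mathbb C$, let $V_{2k-1}^{n}$ denote the $(2k-1)\times n$ Vandermonde matrix with entries $x_p^{\,q-1}$. The Toom-$k$ bilinear algorithm with these nodes is the matrix triplet $$(A,B,C)=\big((V_{2k-1}^{k})^T,\ (V_{2k-1}^{k})^T,\ (V_{2k-1}^{2k-1})^{-1}\big).$$ A non-decreasing (in all variables) function $\mathcal E$ of three natural numbers with real values is an expansion bound for a bilinear algorithm $(A,B,C)$ whose matrices have $R$ columns if, for every $\ell\in\{1,\dots,R\}$ and every matrix $P$ formed by $\ell$ different columns of the $R\times R$ identity matrix, $$\ell\le \mathcal E\big(\mathrm{rank}(AP),\mathrm{rank}(BP),\mathrm{rank}(CP)\big).$$ Let $\tau\ge 1$, let $k_1,\dots,k_\tau\ge 2$ be integers, put $k_{\min}=\min_i k_i$, and for each $i$ let $(A_i,B_i,C_i)$ be a Toom-$k_i$ bilinear algorithm (each $i$ with its own set of pairwise distinct complex nodes). Then $$\mathcal E(r_A,r_B,r_C)=\min(r_A,r_B)^{\log_{k_{\min}}(2k_{\min}-1)}$$ is an expansion bound for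 the nested bilinear algorithm $\big(\bigotimes_{i=1}^\tau A_i,\ \bigotimes_{i=1}^\tau B_i,\ \bigotimes_{i=1}^\tau C_i\big)$. -/

import Mathlib

/-- A bilinear algorithm over `ℂ`: encoding matrices `A`, `B` and a decoding matrix `C`, all with
columns indexed by the finite type `R`. The rank of the algorithm is the number `Fintype.card R`
of columns. -/
structure BilinearAlgorithm (mA mB mC R : Type) where
  A : Matrix mA R ℂ
  B : Matrix mB R ℂ
  C : Matrix mC R ℂ

/-- The bilinear map `(x, y) ↦ C [(Aᵀ x) ⊙ (Bᵀ y)]` computed by a bilinear algorithm. -/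
def BilinearAlgorithm.eval {mA mB mC R : Type} [Fintype mA] [Fintype mB] [Fintype R]
    (F : BilinearAlgorithm mA mB mC R) (x : mA → ℂ) (y : mB → ℂ) : mC → ℂ :=
  F.C.mulVec (F.A.transpose.mulVec x * F.B.transpose.mulVec y)

/-- The Kronecker product `A₀ ⊗ A₁ ⊗ ⋯ ⊗ A_{τ-1}`. As for Mathlib's binary Kronecker product, rows
and columns are indexed by tuples: the entry at a tuple of rows and a tuple of columns is the
product of the corresponding entries of the factors. -/
def kroneckerFamily {τ : ℕ} {m n : Fin τ → Type} (A : ∀ i, Matrix (m i) (n i) ℂ) :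
    Matrix (∀ i, m i) (∀ i, n i) ℂ :=
  Matrix.of fun r c => ∏ i, A i (r i) (c i)

/-- The product of a family is, up to the identification of tuples with pairs of a head and a tail,
the binary Kronecker product of the first factor with the product of the remaining ones. -/
theorem kroneckerFamily_succ {τ : ℕ} {m n : Fin (τ + 1) → Type}
    (A : ∀ i, Matrix (m i) (n i) ℂ) :
    (kroneckerFamily A).submatrix (Fin.consEquiv m) (Fin.consEquiv n) =
      Matrix.kronecker (A 0) (kroneckerFamily fun i : Fin τ => A i.succ) := by
  ext r c
  simp [kroneckerFamily, Fin.prod_univ_succ, Fin.consEquiv]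

/-- The nested bilinear algorithm `(⨂ Aᵢ, ⨂ Bᵢ, ⨂ Cᵢ)`. -/
def nestedBilinear {τ : ℕ} {mA mB mC R : Fin τ → Type}
    (F : ∀ i, BilinearAlgorithm (mA i) (mB i) (mC i) (R i)) :
    BilinearAlgorithm (∀ i, mA i) (∀ i, mB i) (∀ i, mC i) (∀ i, R i) where
  A := kroneckerFamily fun i => (F i).A
  B := kroneckerFamily fun i => (F i).B
  C := kroneckerFamily fun i => (F i).C

/-- The matrices formed by `ℓ` different columns of the identity matrix with index set `R`. -/
def columnSelections (R : Type) [DecidableEq R] (ℓ : ℕ) : Set (Matrix R (Fin ℓ) ℂ) :=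
  {P | ∃ c : Fin ℓ → R, Function.Injective c ∧ P = (1 : Matrix R R ℂ).submatrix id c}

/-- `E` is an expansion bound for the bilinear algorithm `F`: it is non-decreasing in all
variables and bounds the number of columns of `P` by its value at the ranks of `A P`, `B P`, `C P`,
for every selection `P` of at least one column. -/
def IsExpansionBound {mA mB mC R : Type} [Fintype R] [DecidableEq R]
    (F : BilinearAlgorithm mA mB mC R) (E : ℕ → ℕ → ℕ → ℝ) : Prop :=
  (∀ a a' b b' c c' : ℕ, a ≤ a' → b ≤ b' → c ≤ c' → E a b c ≤ E a' b' c') ∧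
  ∀ ℓ ∈ Set.Icc 1 (Fintype.card R), ∀ P ∈ columnSelections R ℓ,
    (ℓ : ℝ) ≤ E (F.A * P).rank (F.B * P).rank (F.C * P).rank

/-- The `m × n` Vandermonde matrix of the nodes `x`, whose row `p` is `1, x p, …, (x p) ^ (n - 1)`. -/
def vandermondeRect {m : ℕ} (x : Fin m → ℂ) (n : ℕ) : Matrix (Fin m) (Fin n) ℂ :=
  Matrix.of fun p q => x p ^ (q : ℕ)

/-- The Toom-`k` bilinear algorithm with evaluation nodes `x` (to be used with distinct nodes):
both encoding matrices are the transposed `(2k-1) × k` Vandermonde matrix, and the decoding matrix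
is the inverse of the `(2k-1) × (2k-1)` Vandermonde matrix. -/
noncomputable def toomCook (k : ℕ) (x : Fin (2 * k - 1) → ℂ) :
    BilinearAlgorithm (Fin k) (Fin k) (Fin (2 * k - 1)) (Fin (2 * k - 1)) where
  A := (vandermondeRect x k).transpose
  B := (vandermondeRect x k).transpose
  C := (vandermondeRect x (2 * k - 1))⁻¹

/-! The two encoding matrices coincide, so it suffices to bound `ℓ` by `rank ^ α` with `α =
log_{kmin}(2 kmin - 1)`. The property `HasLargeIndepSubsets` is carried through Kronecker products
by induction on the number of factors. For `A ⊗ B`, cut `S` into fibres over the `2k-1` columns of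
`A` and choose a large independent set in each fibre. Any `k` columns of `A` are independent, so the
chosen sets over the `k` best fibres are jointly independent. The `k-1` discarded fibres are paid
for by convexity of `t ^ α` and by `2k-1 ≤ k ^ α`, which holds for all `k ≥ kmin`. -/

open Finset in
/-- Every finite set `S` of columns of `A` contains a linearly independent set `T` with
`#S ≤ #T ^ α`. -/
def HasLargeIndepSubsets {m n : Type} (A : Matrix m n ℂ) (α : ℝ) : Prop :=
  ∀ S : Finset n, ∃ T ⊆ S, LinearIndepOn ℂ A.col (T : Set n) ∧ (#S : ℝ) ≤ (#T : ℝ) ^ α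

/-! ### Convexity inequalities -/

/-- Both `d + e` and `s` are convex combinations of `d` and `s + e`, with swapped weights; add the
two convexity inequalities. -/
theorem rpow_add_sub_rpow_le {α d s e : ℝ} (hα : 1 ≤ α) (hd : 0 ≤ d) (hs : d ≤ s) (he : 0 ≤ e) :
    (d + e) ^ α - d ^ α ≤ (s + e) ^ α - s ^ α := by
  rcases eq_or_lt_of_le (show 0 ≤ s + e - d by linarith) with h | h
  · obtain rfl : e = 0 := by linarith
    simp
  · have hc := (convexOn_rpow hα).2
    have hw : 0 ≤ e / (s + e - d) := by positivity
    have hw' : 0 ≤ (s - d) / (s + e - d) := div_nonneg (by linarith) h.le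
    have hsum : e / (s + e - d) + (s - d) / (s + e - d) = 1 := by
      field_simp; ring
    have hD : d ∈ Set.Ici (0 : ℝ) := hd
    have hE : s + e ∈ Set.Ici (0 : ℝ) := by simp only [Set.mem_Ici]; linarith
    have h1 := hc hE hD hw hw' hsum
    have h2 := hc hD hE hw hw' hsum
    have e1 : e / (s + e - d) * (s + e) + (s - d) / (s + e - d) * d = d + e := by
      field_simp; ring
    have e2 : e / (s + e - d) * d + (s - d) / (s + e - d) * (s + e) = s := by
      field_simp; ring
    simp only [smul_eq_mul, e1, e2] at h1 h2
    have h3 : e / (s + e - d) * (s + e) ^ α + (s - d) / (s + e - d) * (s + e) ^ α = (s + e) ^ α := by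
      rw [← add_mul, hsum, one_mul]
    have h4 : e / (s + e - d) * d ^ α + (s - d) / (s + e - d) * d ^ α = d ^ α := by
      rw [← add_mul, hsum, one_mul]
    linarith

theorem sum_rpow_sub_rpow_le {ι : Type} {α δ X : ℝ} (hα : 1 ≤ α) (hδ : 0 ≤ δ) (hX : δ ≤ X)
    (J : Finset ι) (d : ι → ℝ) (hd : ∀ j ∈ J, δ ≤ d j) :
    ∑ j ∈ J, (d j ^ α - δ ^ α) ≤ (X + ∑ j ∈ J, (d j - δ)) ^ α - X ^ α := by
  classical
  induction J using Finset.induction_on with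
  | empty => simp
  | insert a J ha ih =>
    have hJ := ih fun j hj => hd j (Finset.mem_insert_of_mem hj)
    have hnn : 0 ≤ ∑ j ∈ J, (d j - δ) :=
      Finset.sum_nonneg fun j hj => sub_nonneg.2 (hd j (Finset.mem_insert_of_mem hj))
    have hstep := rpow_add_sub_rpow_le (s := X + ∑ j ∈ J, (d j - δ)) hα hδ (by linarith)
      (sub_nonneg.2 (hd a (Finset.mem_insert_self a J)))
    rw [Finset.sum_insert ha, Finset.sum_insert ha]
    rw [add_sub_cancel] at hstep
    have : X + (d a - δ + ∑ j ∈ J, (d j - δ)) = X + ∑ j ∈ J, (d j - δ) + (d a - δ) := by ring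
    rw [this]
    linarith

/-- If every `d j` equals `δ`, this is `hcard` scaled by `δ ^ α`. Raising each `d j` from `δ` then
increases the right side at least as much as the left. -/
theorem sum_rpow_add_le_sum_rpow {ι : Type} {α δ : ℝ} (hα : 1 ≤ α) (hδ : 0 ≤ δ) (K : Finset ι)
    (hK : K.Nonempty) (hcard : 2 * (K.card : ℝ) - 1 ≤ (K.card : ℝ) ^ α) (d : ι → ℝ)
    (hd : ∀ j ∈ K, δ ≤ d j) :
    ∑ j ∈ K, d j ^ α + ((K.card : ℝ) - 1) * δ ^ α ≤ (∑ j ∈ K, d j) ^ α := by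
  have h1 : (1 : ℝ) ≤ K.card := by exact_mod_cast hK.card_pos
  have h := sum_rpow_sub_rpow_le hα hδ (le_mul_of_one_le_left hδ h1) K d hd
  have hmul : (2 * (K.card : ℝ) - 1) * δ ^ α ≤ ((K.card : ℝ) * δ) ^ α := by
    rw [Real.mul_rpow (by positivity) hδ]
    exact mul_le_mul_of_nonneg_right hcard (by positivity)
  simp only [Finset.sum_sub_distrib, Finset.sum_const, nsmul_eq_mul, add_sub_cancel] at h
  linarith

theorem exists_finset_card_eq_forall_le {ι : Type} [Fintype ι] (d : ι → ℕ) (k : ℕ)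
    (hk : k ≤ Fintype.card ι) :
    ∃ K : Finset ι, K.card = k ∧ ∀ a ∈ K, ∀ b ∉ K, d b ≤ d a := by
  classical
  induction k with
  | zero => exact ⟨∅, by simp⟩
  | succ k ih =>
    obtain ⟨K, hK, hle⟩ := ih (by omega)
    have hne : Kᶜ.Nonempty := by
      rw [← Finset.card_pos, Finset.card_compl]
      omega
    obtain ⟨c, hc, hmax⟩ := Finset.exists_max_image Kᶜ d hne
    rw [Finset.mem_compl] at hc
    refine ⟨insert c K, by rw [Finset.card_insert_of_notMem hc, hK], fun a ha b hb => ?_⟩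
    rw [Finset.mem_insert, not_or] at hb
    rcases Finset.mem_insert.1 ha with rfl | ha
    · exact hmax b (Finset.mem_compl.2 hb.2)
    · exact hle a ha b hb.2

/-! ### Independent columns of Kronecker products -/

theorem linearIndepOn_col_kronecker {m n m' n' : Type} [DecidableEq n] [DecidableEq n']
    (A : Matrix m n ℂ) (B : Matrix m' n' ℂ) (K : Finset n) (T : n → Finset n')
    (hA : LinearIndepOn ℂ A.col (K : Set n))
    (hB : ∀ a ∈ K, LinearIndepOn ℂ B.col (T a : Set n')) :
    LinearIndepOn ℂ (Matrix.kronecker A B).col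
      (((K.sigma T).map (Equiv.sigmaEquivProd n n').toEmbedding : Finset (n × n')) :
        Set (n × n')) := by
  rw [linearIndepOn_finset_iff]
  intro c hc
  rw [Finset.sum_map, Finset.sum_sigma] at hc
  have key : ∀ a ∈ K, ∀ b ∈ T a, c (a, b) = 0 := by
    intro a ha
    have hBa := linearIndepOn_finset_iff.1 (hB a ha) fun b => c (a, b)
    refine hBa ?_
    funext r'
    -- For a fixed row `r'` of `B`, the relation becomes one among the columns of `A`.
    have hAr := linearIndepOn_finset_iff.1 hA fun a => ∑ b ∈ T a, c (a, b) * B r' b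
    have h0 := hAr (by
      funext r
      have := congrFun hc (r, r')
      simp only [Finset.sum_apply, Pi.smul_apply, smul_eq_mul, Matrix.col_apply,
        Pi.zero_apply] at this ⊢
      rw [← this]
      refine Finset.sum_congr rfl fun a _ => ?_
      rw [Finset.sum_mul]
      refine Finset.sum_congr rfl fun b _ => ?_
      simp [Matrix.kronecker, Matrix.kroneckerMap_apply]
      ring) a ha
    simpa [Finset.sum_apply] using h0
  rintro ⟨a, b⟩ hab
  rw [Finset.mem_map] at hab
  obtain ⟨⟨a', b'⟩, hmem, heq⟩ := hab
  rw [Finset.mem_sigma] at hmem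
  rw [← heq]
  exact key a' hmem.1 b' hmem.2

theorem HasLargeIndepSubsets.kronecker {m n m' n' : Type} [Fintype n] {α : ℝ} (hα : 1 ≤ α)
    {k : ℕ} (hk : 1 ≤ k) (hn : Fintype.card n = 2 * k - 1) (hkα : 2 * (k : ℝ) - 1 ≤ (k : ℝ) ^ α)
    (A : Matrix m n ℂ) (hA : ∀ K : Finset n, K.card = k → LinearIndepOn ℂ A.col (K : Set n))
    {B : Matrix m' n' ℂ} (hB : HasLargeIndepSubsets B α) :
    HasLargeIndepSubsets (Matrix.kronecker A B) α := by
  classical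
  intro S
  have hfib := fun a : n => hB ((S.filter fun p => p.1 = a).image Prod.snd)
  choose T hTS hTind hTcard using hfib
  obtain ⟨K, hKcard, hKtop⟩ :=
    exists_finset_card_eq_forall_le (fun a => (T a).card) k (by omega)
  have hKne : K.Nonempty := Finset.card_pos.1 (by omega)
  obtain ⟨a₀, ha₀, hmin⟩ := Finset.exists_min_image K (fun a => (T a).card) hKne
  refine ⟨(K.sigma T).map (Equiv.sigmaEquivProd n n').toEmbedding, ?_,
    linearIndepOn_col_kronecker A B K T (hA K hKcard) fun a _ => hTind a, ?_⟩
  · intro p hp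
    obtain ⟨⟨a, b⟩, hmem, rfl⟩ := Finset.mem_map.1 hp
    obtain ⟨⟨a', b'⟩, hq, rfl⟩ := Finset.mem_image.1 (hTS a (Finset.mem_sigma.1 hmem).2)
    obtain ⟨hq, rfl⟩ := Finset.mem_filter.1 hq
    simpa using hq
  · have hS : (S.card : ℝ) ≤ ∑ a, ((T a).card : ℝ) ^ α := by
      rw [Finset.card_eq_sum_card_fiberwise (f := Prod.fst) (t := Finset.univ) (by simp)]
      push_cast
      refine Finset.sum_le_sum fun a _ => ?_
      refine le_trans ?_ (hTcard a)
      rw [Finset.card_image_of_injOn]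
      rintro ⟨p, q⟩ hp ⟨p', q'⟩ hp' h
      have h1 := (Finset.mem_filter.1 hp).2
      have h2 := (Finset.mem_filter.1 hp').2
      simp_all
    -- Each of the `k - 1` fibres outside `K` is dominated by the smallest one inside.
    have hcompl : ∑ a ∈ Kᶜ, ((T a).card : ℝ) ^ α ≤ ((K.card : ℝ) - 1) * ((T a₀).card : ℝ) ^ α := by
      have hle := Finset.sum_le_card_nsmul Kᶜ (fun a => ((T a).card : ℝ) ^ α)
        (((T a₀).card : ℝ) ^ α) fun a ha => Real.rpow_le_rpow (by positivity)
          (by exact_mod_cast hKtop a₀ ha₀ a (Finset.mem_compl.1 ha)) (by linarith)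
      have hc : (Kᶜ.card : ℝ) = (K.card : ℝ) - 1 := by
        have : Kᶜ.card + 1 = K.card := by
          rw [Finset.card_compl]
          omega
        rw [← this]
        push_cast
        ring
      rwa [nsmul_eq_mul, hc] at hle
    have hmain := sum_rpow_add_le_sum_rpow hα (Nat.cast_nonneg (T a₀).card) K hKne
      (by rw [hKcard]; exact hkα) (fun a => ((T a).card : ℝ))
      fun a ha => by exact_mod_cast hmin a ha
    rw [← Finset.sum_add_sum_compl K] at hS
    rw [Finset.card_map, Finset.card_sigma]
    push_cast
    linarith

theorem HasLargeIndepSubsets.of_submatrix_equiv {m n m' n' : Type} {α : ℝ} {A : Matrix m n ℂ}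
    (e : m' ≃ m) (f : n' ≃ n) (h : HasLargeIndepSubsets (A.submatrix e f) α) :
    HasLargeIndepSubsets A α := by
  classical
  intro S
  obtain ⟨T, hTS, hT, hcard⟩ := h (S.map f.symm.toEmbedding)
  refine ⟨T.map f.toEmbedding, ?_, ?_, by simpa using hcard⟩
  · intro p hp
    obtain ⟨q, hq, rfl⟩ := Finset.mem_map.1 hp
    obtain ⟨r, hr, rfl⟩ := Finset.mem_map.1 (hTS hq)
    simpa using hr
  · rw [linearIndepOn_finset_iff] at hT ⊢
    intro c hc p hp
    obtain ⟨q, hq, rfl⟩ := Finset.mem_map.1 hp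
    refine hT (fun q => c (f q)) ?_ q hq
    funext r
    have := congrFun hc (e r)
    rw [Finset.sum_map] at this
    simpa [Finset.sum_apply, Matrix.col_apply] using this

theorem hasLargeIndepSubsets_kroneckerFamily {α : ℝ} (hα : 1 ≤ α) {τ : ℕ} {m n : Fin τ → Type}
    [∀ i, Fintype (n i)] (k : Fin τ → ℕ) (hk : ∀ i, 1 ≤ k i)
    (hn : ∀ i, Fintype.card (n i) = 2 * k i - 1)
    (hkα : ∀ i, 2 * (k i : ℝ) - 1 ≤ (k i : ℝ) ^ α) (A : ∀ i, Matrix (m i) (n i) ℂ)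
    (hA : ∀ i, ∀ K : Finset (n i), K.card = k i → LinearIndepOn ℂ (A i).col (K : Set (n i))) :
    HasLargeIndepSubsets (kroneckerFamily A) α := by
  induction τ with
  | zero =>
    intro S
    refine ⟨S, Finset.Subset.refl S, ?_, ?_⟩
    · rw [linearIndepOn_finset_iff]
      intro c hc p hp
      have hS : S = {p} := Finset.eq_singleton_iff_unique_mem.2
        ⟨hp, fun q _ => Subsingleton.elim q p⟩
      -- The empty product is the `1 × 1` matrix with entry `1`.
      have := congrFun hc fun i => i.elim0
      simpa [hS, kroneckerFamily] using this
    · have hS : S.card ≤ 1 := Finset.card_le_one.2 fun a _ b _ => Subsingleton.elim a b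
      interval_cases S.card
      · simp only [Nat.cast_zero]
        positivity
      · simp
  | succ τ ih =>
    refine HasLargeIndepSubsets.of_submatrix_equiv (Fin.consEquiv m) (Fin.consEquiv n) ?_
    rw [kroneckerFamily_succ]
    exact HasLargeIndepSubsets.kronecker hα (hk 0) (hn 0) (hkα 0) (A 0) (hA 0)
      (ih (fun i => k i.succ) (fun i => hk i.succ) (fun i => hn i.succ) (fun i => hkα i.succ)
        (fun i => A i.succ) fun i => hA i.succ)

/-! ### Toom-Cook matrices and the exponent -/

theorem linearIndepOn_col_vandermondeRect_transpose {m k : ℕ} {x : Fin m → ℂ}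
    (hx : Function.Injective x) (K : Finset (Fin m)) (hK : K.card = k) :
    LinearIndepOn ℂ (vandermondeRect x k).transpose.col (K : Set (Fin m)) := by
  have e : Fin k ≃ K := (K.equivFinOfCardEq hK).symm
  have hdet : (Matrix.vandermonde fun i => x (e i)).det ≠ 0 :=
    Matrix.det_vandermonde_ne_zero_iff.2 fun i j h => e.injective (Subtype.ext (hx h))
  have hrows := Matrix.linearIndependent_rows_of_det_ne_zero hdet
  exact (linearIndependent_equiv e).1 hrows

/-- Equality holds at `k = m`. Beyond that, Bernoulli bounds the power below by its tangent at `m`,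
whose slope is at least `2` once `α ≥ 2m / (2m - 1)`. -/
theorem two_mul_sub_one_le_rpow_logb {m k : ℕ} (hm : 2 ≤ m) (hmk : m ≤ k) :
    2 * (k : ℝ) - 1 ≤ (k : ℝ) ^ Real.logb m (2 * (m : ℝ) - 1) := by
  have hm2 : (2 : ℝ) ≤ m := by exact_mod_cast hm
  have hmk' : (m : ℝ) ≤ k := by exact_mod_cast hmk
  have hm0 : (0 : ℝ) < m := by linarith
  have hy : (0 : ℝ) < 2 * m - 1 := by linarith
  have hlog : 0 < Real.log m := Real.log_pos (by linarith)
  have hα : 2 * (m : ℝ) / (2 * m - 1) ≤ Real.logb m (2 * (m : ℝ) - 1) := by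
    rw [Real.logb, div_le_div_iff₀ hy hlog]
    -- Multiplied by `2m - 1`, this gives `(2m - 1) log ((2m - 1) / m) ≥ m - 1 ≥ log m`.
    have h1 := Real.one_sub_inv_le_log_of_pos (div_pos hy hm0)
    rw [Real.log_div hy.ne' hm0.ne', inv_div] at h1
    have h2 := Real.log_le_sub_one_of_pos hm0
    have h3 := mul_le_mul_of_nonneg_right h1 hy.le
    have h4 : (1 - (m : ℝ) / (2 * m - 1)) * (2 * m - 1) = m - 1 := by
      rw [sub_mul, div_mul_cancel₀ _ hy.ne']
      ring
    linarith
  have hα1 : 1 ≤ Real.logb m (2 * (m : ℝ) - 1) := by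
    refine le_trans ?_ hα
    rw [le_div_iff₀ hy]
    linarith
  have hs : 0 ≤ ((k : ℝ) - m) / m := div_nonneg (by linarith) hm0.le
  have hB := one_add_mul_self_le_rpow_one_add (s := ((k : ℝ) - m) / m) (by linarith) hα1
  have hk : (k : ℝ) = m * (1 + ((k : ℝ) - m) / m) := by
    field_simp
    ring
  have hpow : (m : ℝ) ^ Real.logb m (2 * (m : ℝ) - 1) = 2 * m - 1 :=
    Real.rpow_logb hm0 (by linarith) hy
  calc 2 * (k : ℝ) - 1
      = (2 * m - 1) * (1 + 2 * (m : ℝ) / (2 * m - 1) * (((k : ℝ) - m) / m)) := by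
        field_simp
        ring
    _ ≤ (2 * m - 1) * (1 + Real.logb m (2 * (m : ℝ) - 1) * (((k : ℝ) - m) / m)) := by
        gcongr
    _ ≤ (2 * m - 1) * (1 + ((k : ℝ) - m) / m) ^ Real.logb m (2 * (m : ℝ) - 1) := by
        gcongr
    _ = (k : ℝ) ^ Real.logb m (2 * (m : ℝ) - 1) := by
        conv_rhs => rw [hk, Real.mul_rpow hm0.le (by linarith), hpow]

theorem one_le_logb_two_mul_sub_one {m : ℕ} (hm : 2 ≤ m) :
    1 ≤ Real.logb m (2 * (m : ℝ) - 1) := by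
  have hm2 : (2 : ℝ) ≤ m := by exact_mod_cast hm
  rw [Real.le_logb_iff_rpow_le (by linarith) (by linarith), Real.rpow_one]
  linarith

/-! ### From independent columns to ranks -/

theorem card_le_rank_mul_columnSelection {m n : Type} [Fintype m] [Fintype n] [DecidableEq n]
    (A : Matrix m n ℂ) {ℓ : ℕ} (c : Fin ℓ → n) (T : Finset n) (hT : ∀ t ∈ T, ∃ i, c i = t)
    (hA : LinearIndepOn ℂ A.col (T : Set n)) :
    T.card ≤ (A * (1 : Matrix n n ℂ).submatrix id c).rank := by
  have hmul : A * (1 : Matrix n n ℂ).submatrix id c = A.submatrix id c := by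
    have := Matrix.mul_submatrix_one (Equiv.refl n) c A
    simpa using this
  rw [hmul, Matrix.rank_eq_finrank_span_cols]
  have hcard : Module.finrank ℂ (Submodule.span ℂ (Set.range fun t : (T : Set n) => A.col t)) =
      T.card := by
    rw [finrank_span_eq_card hA]
    simp
  rw [← hcard]
  refine Submodule.finrank_mono (Submodule.span_mono ?_)
  rintro _ ⟨⟨t, ht⟩, rfl⟩
  obtain ⟨i, rfl⟩ := hT t ht
  exact ⟨i, rfl⟩

theorem HasLargeIndepSubsets.card_le_rank_rpow {m n : Type} [Fintype m] [Fintype n]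
    [DecidableEq n] {A : Matrix m n ℂ} {α : ℝ} (hα : 0 ≤ α) (h : HasLargeIndepSubsets A α)
    {ℓ : ℕ} {c : Fin ℓ → n} (hc : Function.Injective c) :
    (ℓ : ℝ) ≤ ((A * (1 : Matrix n n ℂ).submatrix id c).rank : ℝ) ^ α := by
  obtain ⟨T, hTS, hT, hcard⟩ := h (Finset.univ.image c)
  rw [Finset.card_image_of_injective _ hc, Finset.card_univ, Fintype.card_fin] at hcard
  refine hcard.trans (Real.rpow_le_rpow (by positivity) ?_ hα)
  exact_mod_cast card_le_rank_mul_columnSelection A c T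
    (fun t ht => by simpa using hTS ht) hT

theorem mainTheorem8 {τ : ℕ} [NeZero τ] (k : Fin τ → ℕ) (hk : ∀ i, 2 ≤ k i)
    (x : ∀ i, Fin (2 * k i - 1) → ℂ) (hx : ∀ i, Function.Injective (x i))
    (kmin : ℕ) (hkmin : kmin = Finset.univ.inf' Finset.univ_nonempty k) :
    IsExpansionBound (nestedBilinear fun i => toomCook (k i) (x i))
      (fun rA rB _ => ((min rA rB : ℕ) : ℝ) ^ Real.logb (kmin : ℝ) (2 * (kmin : ℝ) - 1)) := by
  have hle : ∀ i, kmin ≤ k i := fun i => hkmin ▸ Finset.inf'_le k (Finset.mem_univ i)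
  have h2 : 2 ≤ kmin := hkmin ▸ (Finset.le_inf'_iff _ _).2 fun i _ => hk i
  have hα := one_le_logb_two_mul_sub_one h2
  constructor
  · intro a a' b b' _ _ ha hb _
    refine Real.rpow_le_rpow (by positivity) ?_ (by linarith)
    exact_mod_cast min_le_min ha hb
  · rintro ℓ - P ⟨c, hc, rfl⟩
    have hlarge : HasLargeIndepSubsets
        (kroneckerFamily fun i => (vandermondeRect (x i) (k i)).transpose)
        (Real.logb (kmin : ℝ) (2 * (kmin : ℝ) - 1)) :=
      hasLargeIndepSubsets_kroneckerFamily hα k (fun i => by linarith [hk i]) (fun i => by simp)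
        (fun i => two_mul_sub_one_le_rpow_logb h2 (hle i)) _
        fun i K hK => linearIndepOn_col_vandermondeRect_transpose (hx i) K hK
    have hrank := hlarge.card_le_rank_rpow (by linarith) hc
    simpa only [nestedBilinear, toomCook, min_self] using hrank
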